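/- Let $n$ individuals each have a strong order (a linear order) on a finite set $X$ of alternatives; such an $n$-tuple $u=(u(1),\dots,u(n))$ is a profile. The Borda score $S(u,x)$ of an alternative $x$ is the sum over all individuals of the position of $x$ in the individual's order (position $1$ being the top), and the Borda ranking $f_B(u)$ is the weak order that ranks $x$ at least as high as $y$ if and only if $S(u,x)\le S(u,y)$. A sequence $(m_1,\dots,m_T)$ of positive integers is in the Borda range for $n$ if there is a profile $u$ of $n$ strong orders on a set of $m_1+\dots+m_T$ alternatives such that $f_B(u)=X_1\succ X_2\succ\dots\succ X_T$ with $|X_i|=m_i$ for every $i$, where the $X_i$ are the classes of alternatives with equal Borda score. Lemma. For every integer $k\ge 0$, each of the following sequences, in which exactly two terms equal $2$ and exactly $k$ terms equal to $4$ stand between the two $2$s, is in the Borda range for $n=3$, and in fact for every odd $n\ge 3$: $$(2,\underbrace{4,\dots,4}_{k},2),\qquad (4,2,\underbrace{4,\dots,4}_{k},2),\qquad (2,\underbrace{4,\dots,4}_{k},2,4),\qquad (4,2,\underbrace{4,\dots,4}_{k},2,4).$$ -/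

import Mathlib

/-- A weak order on `X` (reflexive, complete, transitive); `R.rel x y` reads "`x` is ranked
at least as high as `y`". -/
@[ext]
structure WeakOrder (X : Type*) where
  rel : X → X → Prop
  refl : ∀ x, rel x x
  complete : ∀ x y, x ≠ y → rel x y ∨ rel y x
  trans : ∀ x y z, rel x y → rel y z → rel x z

/-- A strong order: a weak order in which distinct alternatives are never tied. -/
structure StrongOrder (X : Type*) extends WeakOrder X where
  antisymm : ∀ x y, rel x y → rel y x → x = y

/-- A profile of the individuals `Fin n`: a strong order on `X` for each of them. -/
abbrev Profile (n : ℕ) (X : Type*) := Fin n → StrongOrder X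

/-- The position of `x` in `r`: it is `k` when `x` is the `k`-th ranked alternative (`1` for the
top one), that is, when exactly `k` alternatives, `x` included, are ranked at least as high
as `x`. -/
noncomputable def StrongOrder.position {X : Type*} (r : StrongOrder X) (x : X) : ℕ :=
  {y | r.rel y x}.ncard

/-- The Borda score of `x`: the sum of its positions over all individuals. -/
noncomputable def bordaScore {n : ℕ} {X : Type*} (u : Profile n X) (x : X) : ℕ :=
  ∑ i, (u i).position x

/-- The Borda ranking: a lower Borda score is better, equal scores are tied. -/
def bordaRanking {n : ℕ} {X : Type*} (u : Profile n X) : WeakOrder X where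
  rel x y := bordaScore u x ≤ bordaScore u y
  refl _ := le_rfl
  complete _ _ _ := le_total _ _
  trans _ _ _ := le_trans

/-- `R` is `X₁ ≻ X₂ ≻ ⋯ ≻ X_T` with nonempty levels of cardinalities `m = (m₁, …, m_T)`.
The levels are the fibres of `lvl`: alternatives of one level are tied, and every alternative of an
earlier level is strictly above every alternative of a later one. -/
def WeakOrder.HasLevelSizes {X : Type*} (R : WeakOrder X) (m : List ℕ) : Prop :=
  ∃ lvl : X → Fin m.length,
    (∀ x y, R.rel x y ↔ lvl x ≤ lvl y) ∧
    ∀ i, {x | lvl x = i}.Nonempty ∧ {x | lvl x = i}.ncard = m.get i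

/-- The sequence `m = (m₁, …, m_T)` is in the Borda range for `n` individuals: some profile of `n`
strong orders on a set of `m₁ + ⋯ + m_T` alternatives has a Borda ranking with level sizes `m`.
By neutrality (`InBordaRange.forall_weakOrder` below) every weak order
with these level sizes is then a Borda ranking. -/
def InBordaRange (n : ℕ) (m : List ℕ) : Prop :=
  ∃ u : Profile n (Fin m.sum), (bordaRanking u).HasLevelSizes m

/-- Renaming the alternatives of a strong order. -/
def StrongOrder.rename {X Y : Type*} (e : X ≃ Y) (r : StrongOrder X) : StrongOrder Y where
  rel a b := r.rel (e.symm a) (e.symm b)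
  refl _ := r.refl _
  complete _ _ h := r.complete _ _ (fun h' => h (e.symm.injective h'))
  trans _ _ _ := r.trans _ _ _
  antisymm _ _ h h' := e.symm.injective (r.antisymm _ _ h h')

theorem StrongOrder.position_rename {X Y : Type*} (e : X ≃ Y) (r : StrongOrder X) (a : Y) :
    (r.rename e).position a = r.position (e.symm a) := by
  unfold StrongOrder.position
  have : {y | (r.rename e).rel y a} = e '' {y | r.rel y (e.symm a)} := by
    ext y
    constructor
    · intro h
      exact ⟨e.symm y, h, by simp⟩
    · rintro ⟨z, hz, rfl⟩
      simpa [StrongOrder.rename] using hz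
  rw [this, Set.ncard_image_of_injective _ e.injective]

/-- Neutrality: if `m` is in the Borda range for `n`, then every weak order with level sizes `m`,
on any finite set of alternatives, is the Borda ranking of a profile of `n` strong orders. -/
theorem InBordaRange.forall_weakOrder {n : ℕ} {m : List ℕ} (h : InBordaRange n m)
    {X : Type*} [Finite X] (R : WeakOrder X) (hR : R.HasLevelSizes m) :
    ∃ u : Profile n X, bordaRanking u = R := by
  obtain ⟨u, l₁, h₁, c₁⟩ := h
  obtain ⟨l₂, h₂, c₂⟩ := hR
  have key : ∀ i, Nonempty ({x // l₁ x = i} ≃ {x // l₂ x = i}) := fun i =>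
    Finite.card_eq.1 ((c₁ i).2.trans (c₂ i).2.symm)
  let e : Fin m.sum ≃ X := ((Equiv.sigmaFiberEquiv l₁).symm.trans
    (Equiv.sigmaCongrRight fun i => (key i).some)).trans (Equiv.sigmaFiberEquiv l₂)
  have he : ∀ a, l₂ (e a) = l₁ a := fun a => ((key (l₁ a)).some ⟨a, rfl⟩).2
  have hs : ∀ x, bordaScore (fun i => (u i).rename e) x = bordaScore u (e.symm x) := fun x => by
    simp only [bordaScore, StrongOrder.position_rename]
  refine ⟨fun i => (u i).rename e, ?_⟩
  ext x y
  have hx := he (e.symm x)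
  have hy := he (e.symm y)
  rw [Equiv.apply_symm_apply] at hx hy
  rw [h₂, hx, hy, ← h₁]
  change bordaScore _ x ≤ bordaScore _ y ↔ bordaScore u _ ≤ bordaScore u _
  rw [hs, hs]

/-! ### Transporting profiles and adding two opposed voters -/

/-! Two opposed voters add the same constant to every score, so three voters suffice
(`InBordaRange.add_two`). For three voters the profile is built from the top down by finite blocks
of alternatives, each given by its vectors of positions. Between blocks, each voter has filled an
initial segment of positions and a few beyond it. Only two such patterns, `evenState` and
`oddState`, are needed: a tied block of four moves the base by 4 and exchanges them, so it can be
repeated `k` times. Opening blocks lead from nothing to `evenState`; closing blocks, one per parity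
and ending, fill all gaps. Shifting a block by the base `b` adds `n * b` to its scores, so
`HasTable.append` reduces the strict order between blocks to a threshold relative to the base, and
each block is a finite check. -/

theorem bordaScore_rename {n : ℕ} {X Y : Type*} (e : X ≃ Y) (u : Profile n X) (a : Y) :
    bordaScore (fun i => (u i).rename e) a = bordaScore u (e.symm a) := by
  simp only [bordaScore, StrongOrder.position_rename]

theorem InBordaRange.of_card_eq {n : ℕ} {m : List ℕ} {X : Type*} [Fintype X]
    (hX : Fintype.card X = m.sum) (u : Profile n X) (hu : (bordaRanking u).HasLevelSizes m) :
    InBordaRange n m := by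
  obtain ⟨lvl, hrel, hsize⟩ := hu
  let e : X ≃ Fin m.sum := Fintype.equivFinOfCardEq hX
  refine ⟨fun i => (u i).rename e, lvl ∘ e.symm, fun x y => ?_, fun i => ?_⟩
  · change bordaScore _ x ≤ bordaScore _ y ↔ _
    rw [bordaScore_rename, bordaScore_rename]
    exact hrel _ _
  · have himage : {x | (lvl ∘ e.symm) x = i} = e '' {x | lvl x = i} := by
      ext x
      simp [e.image_eq_preimage_symm]
    rw [himage, Set.ncard_image_of_injective _ e.injective]
    exact ⟨(hsize i).1.image e, (hsize i).2⟩

/-- The usual order of `Fin N`, with `0` on top. -/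
def StrongOrder.fin (N : ℕ) : StrongOrder (Fin N) where
  rel a b := a ≤ b
  refl _ := le_rfl
  complete _ _ _ := le_total _ _
  trans _ _ _ := le_trans
  antisymm _ _ := le_antisymm

/-- The opposite of the usual order of `Fin N`. -/
def StrongOrder.finRev (N : ℕ) : StrongOrder (Fin N) where
  rel a b := b ≤ a
  refl _ := le_rfl
  complete _ _ _ := le_total _ _
  trans _ _ _ h h' := le_trans h' h
  antisymm _ _ h h' := le_antisymm h' h

theorem StrongOrder.position_fin {N : ℕ} (x : Fin N) :
    (StrongOrder.fin N).position x = x + 1 := by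
  change (Set.Iic x).ncard = _
  rw [← Finset.coe_Iic, Set.ncard_coe_finset, Fin.card_Iic]

theorem StrongOrder.position_finRev {N : ℕ} (x : Fin N) :
    (StrongOrder.finRev N).position x = N - x := by
  change (Set.Ici x).ncard = _
  rw [← Finset.coe_Ici, Set.ncard_coe_finset, Fin.card_Ici]

/-- The opposed voters put `x` at positions `x + 1` and `m.sum - x`, whose sum does not depend on
`x`. -/
theorem InBordaRange.add_two {n : ℕ} {m : List ℕ} (h : InBordaRange n m) :
    InBordaRange (n + 2) m := by
  obtain ⟨u, lvl, hrel, hsize⟩ := h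
  let w : Profile (n + 2) (Fin m.sum) :=
    Fin.cons (StrongOrder.fin _) (Fin.cons (StrongOrder.finRev _) u : Profile (n + 1) (Fin m.sum))
  have hw : ∀ x, bordaScore w x = bordaScore u x + (m.sum + 1) := fun x => by
    have hx := x.isLt
    simp only [bordaScore, Fin.sum_univ_succ, w, Fin.cons_zero, Fin.cons_succ,
      StrongOrder.position_fin, StrongOrder.position_finRev]
    omega
  refine ⟨w, lvl, fun x y => ?_, hsize⟩
  rw [← hrel]
  change bordaScore w x ≤ bordaScore w y ↔ bordaScore u x ≤ bordaScore u y
  rw [hw, hw]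
  omega

theorem InBordaRange.of_odd {n : ℕ} {m : List ℕ} (h : InBordaRange 3 m) (hn : Odd n)
    (hn3 : 3 ≤ n) : InBordaRange n m := by
  obtain ⟨j, rfl⟩ : ∃ j, n = 3 + 2 * j := by
    obtain ⟨a, rfl⟩ := hn
    exact ⟨a - 1, by omega⟩
  clear hn hn3
  induction j with
  | zero => exact h
  | succ j ih => exact ih.add_two

/-! ### Score lists -/

/-- The list in which every score `p.1` is repeated `p.2` times, for the pairs `p` of `s`. -/
def expandScores (s : List (ℕ × ℕ)) : List ℕ :=
  s.flatMap fun p => List.replicate p.2 p.1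

theorem expandScores_append (s t : List (ℕ × ℕ)) :
    expandScores (s ++ t) = expandScores s ++ expandScores t :=
  List.flatMap_append

theorem length_expandScores (s : List (ℕ × ℕ)) :
    (expandScores s).length = (s.map Prod.snd).sum := by
  simp [expandScores, List.length_flatMap]

theorem exists_of_mem_expandScores {s : List (ℕ × ℕ)} {v : ℕ} (h : v ∈ expandScores s) :
    ∃ p ∈ s, p.1 = v := by
  obtain ⟨p, hp, hv⟩ := List.mem_flatMap.1 h
  exact ⟨p, hp, (List.eq_of_mem_replicate hv).symm⟩

/-- Strictly increasing scores prevent two pairs from merging into one level. -/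
theorem count_expandScores {s : List (ℕ × ℕ)} (hs : s.Pairwise fun p q => p.1 < q.1)
    {p : ℕ × ℕ} (hp : p ∈ s) : (expandScores s).count p.1 = p.2 := by
  induction s with
  | nil => simp at hp
  | cons q s ih =>
    obtain ⟨hq, hs⟩ := List.pairwise_cons.1 hs
    have hcons : expandScores (q :: s) = List.replicate q.2 q.1 ++ expandScores s := rfl
    rw [hcons, List.count_append]
    rcases List.mem_cons.1 hp with rfl | hp
    · have h0 : (expandScores s).count p.1 = 0 := List.count_eq_zero.2 fun h => by
        obtain ⟨r, hr, h⟩ := exists_of_mem_expandScores h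
        exact (hq r hr).ne' h
      rw [h0, List.count_replicate_self, add_zero]
    · rw [ih hs hp, List.count_replicate, if_neg (by simpa using (hq p hp).ne), zero_add]

theorem List.ncard_setOf_get_eq {α : Type*} [DecidableEq α] (l : List α) (a : α) :
    {x : Fin l.length | l.get x = a}.ncard = l.count a := by
  have hcount : (Finset.univ.val.map l.get).count a = l.count a := by
    rw [Fin.univ_val_map, List.ofFn_get, Multiset.coe_count]
  rw [← hcount, Multiset.count_map, ← Finset.filter_val, Finset.card_val,
    ← Set.ncard_coe_finset]
  congr 1
  ext x
  simp [eq_comm]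

/-! ### Tables of positions

An alternative is described by its vector of positions, counted from `0`; a list of such vectors
describes the best ranked alternatives of a profile. -/

/-- There is a list of alternatives with level sizes `m` in which voter `i` has filled exactly the
positions below `b` and the positions `b + a` for `a` in `σ i`, and all of whose scores are below
`n * b + v`. -/
def HasTable {n : ℕ} (b : ℕ) (σ : Fin n → List ℕ) (v : ℕ) (m : List ℕ) : Prop :=
  ∃ (L : List (Fin n → ℕ)) (s : List (ℕ × ℕ)),
    (∀ i, (L.map (· i)).Perm (List.range b ++ (σ i).map (b + ·))) ∧
    (L.map fun x => ∑ i, x i).Perm (expandScores s) ∧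
    s.Pairwise (fun p q => p.1 < q.1) ∧
    (∀ p ∈ s, 0 < p.2 ∧ p.1 < n * b + v) ∧
    s.map Prod.snd = m

/-- A block of alternatives that takes the filled positions from `σ` to `τ` while moving the base
by `d`; its scores, relative to the base, are at least `v`, and less than `n * d + w`. -/
structure IsBlock {n : ℕ} (σ τ : Fin n → List ℕ) (v w d : ℕ) (M : List (Fin n → ℕ))
    (t : List (ℕ × ℕ)) : Prop where
  perm : ∀ i, (σ i ++ M.map (· i)).Perm (List.range d ++ (τ i).map (d + ·))
  scores : (M.map fun x => ∑ i, x i).Perm (expandScores t)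
  sorted : t.Pairwise fun p q => p.1 < q.1
  bounds : ∀ p ∈ t, 0 < p.2 ∧ v ≤ p.1 ∧ p.1 < n * d + w
  le : v ≤ n * d + w

theorem HasTable.nil {n : ℕ} : HasTable (n := n) 0 (fun _ => []) 0 [] :=
  ⟨[], [], by simp, by simp [expandScores], by simp, by simp, rfl⟩

theorem HasTable.append {n b v w d : ℕ} {σ τ : Fin n → List ℕ} {m : List ℕ}
    {M : List (Fin n → ℕ)} {t : List (ℕ × ℕ)} (h : HasTable b σ v m)
    (hM : IsBlock σ τ v w d M t) : HasTable (b + d) τ w (m ++ t.map Prod.snd) := by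
  obtain ⟨L, s, hL, hscore, hs, hb, rfl⟩ := h
  refine ⟨L ++ M.map (fun x i => b + x i), s ++ t.map (Prod.map (n * b + ·) id),
    fun i => ?_, ?_, ?_, ?_, ?_⟩
  · have h1 := (hM.perm i).map (b + ·)
    have h2 : (L ++ M.map (fun x i => b + x i)).map (· i) =
        L.map (· i) ++ (M.map (· i)).map (b + ·) := by
      simp [Function.comp_def]
    rw [h2]
    refine ((hL i).append_right _).trans ?_
    rw [List.append_assoc, ← List.map_append]
    refine (h1.append_left _).trans (.of_eq ?_)
    simp [List.range_add, Function.comp_def, add_assoc]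
  · have h1 := hM.scores.map (n * b + ·)
    have h2 : expandScores (t.map (Prod.map (n * b + ·) id)) =
        (expandScores t).map (n * b + ·) := by
      simp [expandScores, List.flatMap_map, List.map_flatMap]
    have h3 : (M.map (fun x i => b + x i)).map (fun x => ∑ i, x i) =
        (M.map fun x => ∑ i, x i).map (n * b + ·) := by
      simp [Function.comp_def, Finset.sum_add_distrib]
    rw [expandScores_append, List.map_append, h2, h3]
    exact hscore.append h1
  · refine List.pairwise_append.2 ⟨hs, ?_, fun p hp q hq => ?_⟩
    · rw [List.pairwise_map]
      exact hM.sorted.imp fun h => Nat.add_lt_add_left h _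
    · obtain ⟨r, hr, rfl⟩ := List.mem_map.1 hq
      have h1 := (hb p hp).2
      have h2 := (hM.bounds r hr).2.1
      simp only [Prod.map_fst]
      omega
  · intro p hp
    -- This keeps the older scores below the new threshold after the base has moved.
    have hle := hM.le
    rw [mul_add]
    rcases List.mem_append.1 hp with hp | hp
    · have h1 := hb p hp
      omega
    · obtain ⟨r, hr, rfl⟩ := List.mem_map.1 hp
      have h1 := hM.bounds r hr
      simp only [Prod.map_fst, Prod.map_snd, id]
      omega
  · simp [Function.comp_def]

/-- With nothing filled beyond the base, each voter's column is a permutation of `0, …, b - 1`,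
hence a strong order. -/
theorem HasTable.inBordaRange {n b v : ℕ} {m : List ℕ}
    (h : HasTable (n := n) b (fun _ => []) v m) (hn : 0 < n) : InBordaRange n m := by
  obtain ⟨L, s, hL, hscore, hs, hb, rfl⟩ := h
  simp only [List.map_nil, List.append_nil] at hL
  have hlen : L.length = b := by simpa using (hL ⟨0, hn⟩).length_eq
  have hcard : Fintype.card (Fin L.length) = (s.map Prod.snd).sum := by
    rw [Fintype.card_fin, ← length_expandScores, ← hscore.length_eq, List.length_map]
  have hlt : ∀ i (x : Fin L.length), L.get x i < L.length := fun i x => by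
    rw [hlen, ← List.mem_range, ← (hL i).mem_iff]
    exact List.mem_map_of_mem (L.get_mem x)
  have hinj : ∀ i, Function.Injective fun x : Fin L.length => (⟨L.get x i, hlt i x⟩ : Fin _) := by
    intro i x y hxy
    have hnd : (L.map (· i)).Nodup := (hL i).nodup_iff.2 List.nodup_range
    have hxy' : L.get x i = L.get y i := congrArg Fin.val hxy
    have := (hnd.getElem_inj_iff (i := x) (j := y) (hi := by simp) (hj := by simp)).1
      (by simpa using hxy')
    exact Fin.ext this
  let e : Fin n → (Fin L.length ≃ Fin L.length) := fun i =>
    Equiv.ofBijective _ (Finite.injective_iff_bijective.1 (hinj i))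
  let u : Profile n (Fin L.length) := fun i => (StrongOrder.fin _).rename (e i).symm
  -- The extra `n` appears because table positions start at 0 and Borda positions at 1.
  have hu : ∀ x, bordaScore u x = ∑ i, L.get x i + n := fun x => by
    simp [bordaScore, u, StrongOrder.position_rename, StrongOrder.position_fin, e,
      Finset.sum_add_distrib]
  have hlevel : ∀ x : Fin L.length, ∃ j : Fin (s.map Prod.snd).length,
      (s[j.val]'(by simpa using j.isLt)).1 = ∑ i, L.get x i := fun x => by
    have hx : ∑ i, L.get x i ∈ expandScores s :=
      hscore.mem_iff.1 (List.mem_map.2 ⟨_, L.get_mem x, rfl⟩)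
    obtain ⟨p, hp, hpx⟩ := exists_of_mem_expandScores hx
    obtain ⟨j, hj, rfl⟩ := List.mem_iff_getElem.1 hp
    exact ⟨⟨j, by simpa using hj⟩, hpx⟩
  choose lvl hlvl using hlevel
  have hmono : StrictMono fun j : Fin (s.map Prod.snd).length =>
      (s[j.val]'(by simpa using j.isLt)).1 := fun j k hjk =>
    List.pairwise_iff_getElem.1 hs _ _ _ _ hjk
  refine InBordaRange.of_card_eq hcard u ⟨lvl, fun x y => ?_, fun j => ?_⟩
  · change bordaScore u x ≤ bordaScore u y ↔ _
    rw [hu, hu, add_le_add_iff_right, ← hlvl, ← hlvl]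
    exact hmono.le_iff_le
  · have hj : j.val < s.length := by simpa using j.isLt
    have hfib : {x | lvl x = j} = {x | ∑ i, L.get x i = s[j.val].1} := by
      ext x
      rw [Set.mem_ofPred_eq, Set.mem_ofPred_eq, ← hlvl]
      exact hmono.injective.eq_iff.symm
    have hncard : {x | lvl x = j}.ncard = s[j.val].2 := by
      rw [hfib, ← count_expandScores hs (List.getElem_mem hj), ← hscore.count_eq,
        ← List.ncard_setOf_get_eq]
      refine Set.ncard_congr (fun x _ => Fin.cast (by simp) x) ?_ ?_ ?_
      · intro x hx
        simpa using hx
      · intro x y _ _ hxy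
        exact Fin.cast_injective _ hxy
      · intro x hx
        exact ⟨Fin.cast (by simp) x, by simpa using hx, rfl⟩
    refine ⟨Set.nonempty_of_ncard_ne_zero ?_, by simpa using hncard⟩
    rw [hncard]
    exact (hb _ (List.getElem_mem hj)).1.ne'

/-! ### Blocks for three voters -/

/-- The filled positions after an even number of levels of size `4`. -/
def evenState : Fin 3 → List ℕ := ![[0, 1], [0, 1], [0, 2]]

/-- The filled positions after an odd number of levels of size `4`. -/
def oddState : Fin 3 → List ℕ := ![[0, 1], [0, 1], [1, 3]]

theorem isBlock_start_two : IsBlock (fun _ => []) evenState 0 3 0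
    [![0, 0, 2], ![1, 1, 0]] [(2, 2)] := by
  constructor <;> decide

theorem isBlock_start_four_two : IsBlock (fun _ => []) evenState 0 3 4
    [![0, 1, 6], ![1, 3, 3], ![2, 5, 0], ![3, 0, 4], ![4, 4, 1], ![5, 2, 2]]
    [(7, 4), (9, 2)] := by
  constructor <;> decide

/-- Scores tie because the first two voters each go down one place while the third goes up two. The
third voter thus fills alternate positions, leaving gaps of the other pattern; `isBlock_odd_four`
reverses the roles. -/
theorem isBlock_even_four : IsBlock evenState oddState 3 3 4
    [![2, 2, 7], ![3, 3, 5], ![4, 4, 3], ![5, 5, 1]] [(11, 4)] := by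
  constructor <;> decide

theorem isBlock_odd_four : IsBlock oddState evenState 3 3 4
    [![2, 2, 6], ![3, 3, 4], ![4, 4, 2], ![5, 5, 0]] [(10, 4)] := by
  constructor <;> decide

theorem isBlock_even_two : IsBlock evenState (fun _ => []) 3 0 4
    [![2, 2, 3], ![3, 3, 1]] [(7, 2)] := by
  constructor <;> decide

theorem isBlock_odd_two : IsBlock oddState (fun _ => []) 3 0 4
    [![2, 2, 2], ![3, 3, 0]] [(6, 2)] := by
  constructor <;> decide

theorem isBlock_even_two_four : IsBlock evenState (fun _ => []) 3 0 8
    [![2, 5, 5], ![3, 3, 6], ![4, 6, 4], ![5, 2, 7], ![6, 7, 1], ![7, 4, 3]]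
    [(12, 2), (14, 4)] := by
  constructor <;> decide

theorem isBlock_odd_two_four : IsBlock oddState (fun _ => []) 3 0 8
    [![2, 4, 5], ![5, 6, 0], ![3, 7, 4], ![4, 3, 7], ![6, 2, 6], ![7, 5, 2]]
    [(11, 2), (14, 4)] := by
  constructor <;> decide

theorem HasTable.append_replicate_four {b : ℕ} {m : List ℕ} (h : HasTable b evenState 3 m)
    (k : ℕ) : ∃ c, HasTable c (if Even k then evenState else oddState) 3
      (m ++ List.replicate k 4) := by
  induction k with
  | zero => exact ⟨b, by simpa using h⟩
  | succ k ih =>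
    obtain ⟨c, hc⟩ := ih
    refine ⟨c + 4, ?_⟩
    rw [List.replicate_succ', ← List.append_assoc]
    by_cases hk : Even k
    · rw [if_pos hk] at hc
      rw [if_neg (by simpa [Nat.even_add_one] using hk)]
      exact hc.append isBlock_even_four
    · rw [if_neg hk] at hc
      rw [if_pos (by simpa [Nat.even_add_one] using hk)]
      exact hc.append isBlock_odd_four

theorem HasTable.inBordaRange_replicate_four {b : ℕ} {m : List ℕ}
    (h : HasTable b evenState 3 m) (k : ℕ) :
    InBordaRange 3 (m ++ List.replicate k 4 ++ [2]) ∧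
      InBordaRange 3 (m ++ List.replicate k 4 ++ [2, 4]) := by
  obtain ⟨c, hc⟩ := h.append_replicate_four k
  by_cases hk : Even k
  · rw [if_pos hk] at hc
    exact ⟨(hc.append isBlock_even_two).inBordaRange three_pos,
      (hc.append isBlock_even_two_four).inBordaRange three_pos⟩
  · rw [if_neg hk] at hc
    exact ⟨(hc.append isBlock_odd_two).inBordaRange three_pos,
      (hc.append isBlock_odd_two_four).inBordaRange three_pos⟩

theorem mainTheorem2 (n : ℕ) (hn : Odd n) (hn3 : 3 ≤ n) (k : ℕ) :
    InBordaRange n ([2] ++ List.replicate k 4 ++ [2]) ∧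
    InBordaRange n ([4, 2] ++ List.replicate k 4 ++ [2]) ∧
    InBordaRange n ([2] ++ List.replicate k 4 ++ [2, 4]) ∧
    InBordaRange n ([4, 2] ++ List.replicate k 4 ++ [2, 4]) := by
  have h2 := (HasTable.nil.append isBlock_start_two).inBordaRange_replicate_four k
  have h42 := (HasTable.nil.append isBlock_start_four_two).inBordaRange_replicate_four k
  exact ⟨h2.1.of_odd hn hn3, h42.1.of_odd hn hn3, h2.2.of_odd hn hn3, h42.2.of_odd hn hn3⟩
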